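/- Let $\mathbb R^\infty=\bigcup_n\mathbb R^n$ be the space of finitely supported real sequences, with standard basis $e_1,e_2,\dots$. Let $G(k,\mathbb R^\infty)=\bigcup_n G(k,\mathbb R^n)$ be the set of $k$-dimensional linear subspaces of $\mathbb R^\infty$ with the colimit topology (a set is open if and only if its intersection with every Grassmannian $G(k,\mathbb R^n)$, taken with its usual topology, is open). A triangulation of a space $X$ is an abstract simplicial complex $K$ together with a homeomorphism from its geometric realization $|K|$, with the weak topology, onto $X$; we regard the simplices of $|K|$ as subsets of $X$, and write $\operatorname{int}\sigma$ for the open simplex of $\sigma$. A triangulation of $G(k,\mathbb R^\infty)$ is called tame if for every simplex $\sigma$, all $V,W\in\operatorname{int}\sigma$ and every $v\in V$ there is $w\in W$ such that $v\cdot e_i=0\Leftrightarrow w\cdot e_i=0$ for all $i$. The oriented matroid stratum of $V\in G(k,\mathbb R^\infty)$ is the set of all $W\in G(k,\mathbb R^\infty)$ with $$\{(\operatorname{sign}(w\cdot e_i))_i : w\in W\}=\{(\operatorname{sign}(v\cdot e_i))_i : v\in V\}.$$ **Theorem.** Let $k\ge 3$. There is no tame triangulation of $G(k,\mathbb R^\infty)$.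 Also, there is no triangulation of $G(k,\mathbb R^\infty)$ for which every oriented matroid stratum is a union of open simplices. In particular, both statements hold for $G(3,\mathbb R^\infty)$. -/

import Mathlib

/-! ### Abstract simplicial complexes: geometric realization, triangulations -/

section Triangulations

variable {ι : Type*}

/-- The underlying set of the geometric realization of an abstract simplicial complex: barycentric
coordinates `x : ι →₀ ℝ` that are nonnegative, sum to `1`, and whose support is a face. -/
def AbstractSimplicialComplex.Realization (K : AbstractSimplicialComplex ι) : Type _ :=
  {x : ι →₀ ℝ // (∀ i, 0 ≤ x i) ∧ (∑ i ∈ x.support, x i = 1) ∧ x.support ∈ K.faces}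

/-- The closed simplex spanned by the vertex set `s`. -/
def AbstractSimplicialComplex.closedSimplex (K : AbstractSimplicialComplex ι) (s : Finset ι) :
    Set K.Realization :=
  {x | x.1.support ⊆ s}

/-- The open simplex (the interior of the simplex) spanned by the vertex set `s`: all the barycentric
coordinates in `s` are nonzero, hence positive, and all the others vanish. -/
def AbstractSimplicialComplex.openSimplex (K : AbstractSimplicialComplex ι) (s : Finset ι) :
    Set K.Realization :=
  {x | x.1.support = s}

/-- The Euclidean topology of a closed simplex, induced by the barycentric coordinates (of which only
the finitely many in `s` can be nonzero). -/
abbrev AbstractSimplicialComplex.closedSimplexTopology (K : AbstractSimplicialComplex ι)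
    (s : Finset ι) : TopologicalSpace (K.closedSimplex s) :=
  TopologicalSpace.induced (fun x (i : ι) => x.1.1 i) Pi.topologicalSpace

/-- The weak topology of the geometric realization: a set is open if and only if its intersection
with each closed simplex is open in the Euclidean topology of that simplex. -/
instance AbstractSimplicialComplex.instTopologicalSpaceRealization
    (K : AbstractSimplicialComplex ι) : TopologicalSpace K.Realization :=
  ⨆ s : K.faces, TopologicalSpace.coinduced
    (Subtype.val : K.closedSimplex s.1 → K.Realization) (K.closedSimplexTopology s.1)

/-- A triangulation of a space `X` with vertices indexed by `ι`: a simplicial complex together with a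
homeomorphism from its geometric realization onto `X`. -/
structure Triangulation (ι : Type*) (X : Type*) [TopologicalSpace X] where
  /-- the simplicial complex -/
  complex : AbstractSimplicialComplex ι
  /-- the homeomorphism -/
  homeo : complex.Realization ≃ₜ X

/-- The open simplex of a triangulation of `X` with vertex set `s`, as a subset of `X`. -/
def Triangulation.openSimplex {X : Type*} [TopologicalSpace X] (T : Triangulation ι X)
    (s : Finset ι) : Set X :=
  T.homeo '' T.complex.openSimplex s

end Triangulations

/-! ### The Grassmannians `G(k, ℝⁿ)` and `G(k, ℝ^∞)` -/

/-- `G(k, ℝⁿ)`: the set of `k`-dimensional linear subspaces of `ℝⁿ`. -/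
def FinGrassmannian (k n : ℕ) : Type :=
  {V : Submodule ℝ (Fin n → ℝ) // Module.finrank ℝ V = k}

/-- The linearly independent `k`-tuples in `ℝⁿ`, topologized as a subspace of `(ℝⁿ)ᵏ`. -/
abbrev LinIndepFrame (k n : ℕ) : Type :=
  {b : Fin k → Fin n → ℝ // LinearIndependent ℝ b}

/-- The `k`-plane spanned by a linearly independent `k`-tuple. -/
def LinIndepFrame.span {k n : ℕ} (b : LinIndepFrame k n) : FinGrassmannian k n :=
  ⟨Submodule.span ℝ (Set.range b.1), by simpa using finrank_span_eq_card b.2⟩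

/-- The usual topology of `G(k, ℝⁿ)`: the quotient topology with respect to the map sending a
linearly independent `k`-tuple to its span. -/
instance instTopologicalSpaceFinGrassmannian (k n : ℕ) : TopologicalSpace (FinGrassmannian k n) :=
  TopologicalSpace.coinduced (LinIndepFrame.span (k := k) (n := n)) inferInstance

/-- `G(k, ℝ^∞)`: the set of `k`-dimensional linear subspaces of `ℝ^∞`, where `ℝ^∞ = ⋃ ℝⁿ` is the
space of finitely supported real sequences. -/
def InfGrassmannian (k : ℕ) : Type :=
  {V : Submodule ℝ (ℕ →₀ ℝ) // FiniteDimensional ℝ V ∧ Module.finrank ℝ V = k}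

/-- The standard inclusion `ℝⁿ → ℝ^∞` (extension by zero). -/
noncomputable def coordInclusion (n : ℕ) : (Fin n → ℝ) →ₗ[ℝ] (ℕ →₀ ℝ) :=
  Finsupp.lmapDomain ℝ ℝ (Fin.val : Fin n → ℕ) ∘ₗ
    (Finsupp.linearEquivFunOnFinite ℝ ℝ (Fin n)).symm.toLinearMap

theorem coordInclusion_injective (n : ℕ) : Function.Injective (coordInclusion n) :=
  (Finsupp.mapDomain_injective Fin.val_injective).comp
    (Finsupp.linearEquivFunOnFinite ℝ ℝ (Fin n)).symm.injective

/-- The inclusion `G(k, ℝⁿ) → G(k, ℝ^∞)`. -/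
noncomputable def FinGrassmannian.toInf {k n : ℕ} (V : FinGrassmannian k n) : InfGrassmannian k :=
  ⟨V.1.map (coordInclusion n), inferInstance,
    (LinearEquiv.finrank_eq (Submodule.equivMapOfInjective _ (coordInclusion_injective n) V.1)).symm.trans
      V.2⟩

/-- The colimit topology of `G(k, ℝ^∞) = ⋃ G(k, ℝⁿ)`: a set is open if and only if its intersection
with each `G(k, ℝⁿ)` is open. -/
noncomputable instance instTopologicalSpaceInfGrassmannian (k : ℕ) : TopologicalSpace (InfGrassmannian k) :=
  ⨆ n : ℕ, TopologicalSpace.coinduced (FinGrassmannian.toInf (k := k) (n := n)) inferInstance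

/-! ### Tameness and oriented matroid strata -/

/-- A triangulation of `G(k, ℝ^∞)` is tame if for every simplex, for all `V`, `W` in its interior and
every `v ∈ V`, there is `w ∈ W` having the same vanishing coordinates as `v`. -/
def Triangulation.IsTame {ι : Type*} {k : ℕ} (T : Triangulation ι (InfGrassmannian k)) : Prop :=
  ∀ s ∈ T.complex.faces, ∀ V ∈ T.openSimplex s, ∀ W ∈ T.openSimplex s,
    ∀ v ∈ V.1, ∃ w ∈ W.1, ∀ i : ℕ, v i = 0 ↔ w i = 0

/-- The covectors of the oriented matroid of `V`: the sign patterns of the vectors of `V`. -/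
def InfGrassmannian.covectors {k : ℕ} (V : InfGrassmannian k) : Set (ℕ → SignType) :=
  {σ | ∃ v ∈ V.1, ∀ i : ℕ, σ i = SignType.sign (v i)}

/-- The oriented matroid stratum of `V`: all `k`-planes with the same oriented matroid as `V`. -/
def InfGrassmannian.orientedStratum {k : ℕ} (V : InfGrassmannian k) : Set (InfGrassmannian k) :=
  {W | W.covectors = V.covectors}

/-- A triangulation of `G(k, ℝ^∞)` refines the oriented matroid stratification if every oriented
matroid stratum is a union of open simplices. -/
def Triangulation.RefinesOrientedStratification {ι : Type*} {k : ℕ}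
    (T : Triangulation ι (InfGrassmannian k)) : Prop :=
  ∀ V : InfGrassmannian k, ∃ F ⊆ T.complex.faces, V.orientedStratum = ⋃ s ∈ F, T.openSimplex s

/-!
A triangulation of `G(k, ℝ^∞)` that refines the oriented matroid stratification is tame, since sign
patterns determine vanishing patterns; so it suffices to exclude tame triangulations.

The topological input is about the weak topology of a realization. A convergent sequence meets only
finitely many open simplices (`finite_range_support_of_tendsto`), and an open simplex that meets
the closure of another one is contained in it (`mem_closure_openSimplex_of_support_eq`). Hence, if
`V n → U`, then the closure of the open simplex of some `V n` contains the whole open simplex of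
`U`.

The geometric input is that incidences can prescribe a cross-ratio. A `k`-plane is a configuration
of vectors, namely the coordinate functionals restricted to it, and the vanishing patterns of its
vectors are the matroid of the configuration. Repeating a translation by parallel projections
yields, for every `N ≥ 1`, a matroid that forces four coordinate functionals on a line to have
cross-ratio `N` (`crossRatio_eq_of_translation_chain`). The auxiliary vectors of the construction
can be scaled by `t → 0`. In the limit they disappear, and what is left is a plane `U N` in a fixed
finite Grassmannian on which those four functionals still have cross-ratio `N`. The condition on
the cross-ratio is a closed one (`isClosed_crossRatioLocus`), so in a tame triangulation the
whole open simplex of `U N` satisfies it. Therefore the planes `U N` lie in pairwise different open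
simplices, but (with suitably scaled coordinates) they form a convergent sequence: a contradiction.
-/

open scoped Topology

/-! ### The weak topology of the geometric realization -/

namespace AbstractSimplicialComplex

variable {ι : Type*} {K : AbstractSimplicialComplex ι}

theorem isClosed_realization_iff {C : Set K.Realization} :
    IsClosed C ↔ ∀ s ∈ K.faces, IsClosed[K.closedSimplexTopology s]
      ((Subtype.val : K.closedSimplex s → K.Realization) ⁻¹' C) := by
  have h : IsClosed C ↔ ∀ s : K.faces, IsClosed[TopologicalSpace.coinduced
      (Subtype.val : K.closedSimplex s.1 → K.Realization) (K.closedSimplexTopology s.1)] C :=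
    isClosed_iSup_iff
  rw [h]
  simp only [isClosed_coinduced, Subtype.forall]

theorem continuous_closedSimplex_val {s : Finset ι} (hs : s ∈ K.faces) :
    Continuous[K.closedSimplexTopology s, K.instTopologicalSpaceRealization]
      (Subtype.val : K.closedSimplex s → K.Realization) :=
  continuous_iSup_rng (i := (⟨s, hs⟩ : K.faces)) continuous_coinduced_rng

theorem continuous_closedSimplex_coord (s : Finset ι) (i : ι) :
    Continuous[K.closedSimplexTopology s, inferInstance]
      (fun x : K.closedSimplex s => x.1.1 i) := by
  let := K.closedSimplexTopology s
  exact (continuous_apply i).comp continuous_induced_dom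

theorem openSimplex_subset_closedSimplex (s : Finset ι) :
    K.openSimplex s ⊆ K.closedSimplex s := by
  intro x hx
  have hx' : x.1.support = s := hx
  exact hx'.subset

theorem isClosed_closedSimplex (s : Finset ι) : IsClosed (K.closedSimplex s) := by
  rw [isClosed_realization_iff]
  intro t _
  let := K.closedSimplexTopology t
  have : ((Subtype.val : K.closedSimplex t → K.Realization) ⁻¹' K.closedSimplex s)
      = ⋂ i ∈ {i | i ∉ s}, {x : K.closedSimplex t | x.1.1 i = 0} := by
    ext x
    have hx : x ∈ ⋂ i ∈ {i | i ∉ s}, {x : K.closedSimplex t | x.1.1 i = 0} ↔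
        ∀ i, i ∉ s → x.1.1 i = 0 := by
      simp only [Set.mem_iInter]
      rfl
    rw [hx, Set.mem_preimage]
    change x.1.1.support ⊆ s ↔ _
    simp only [Finset.subset_iff, Finsupp.mem_support_iff]
    exact forall_congr' fun i => not_imp_comm
  rw [this]
  exact isClosed_biInter fun i _ =>
    isClosed_eq (continuous_closedSimplex_coord t i) continuous_const

/-- A set meeting every closed simplex in a finite set is closed for the weak topology. -/
theorem isClosed_of_finite_inter_closedSimplex {C : Set K.Realization}
    (hC : ∀ s ∈ K.faces, (C ∩ K.closedSimplex s).Finite) : IsClosed C := by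
  rw [isClosed_realization_iff]
  intro s hs
  let := K.closedSimplexTopology s
  have hinj : Function.Injective
      (fun (x : K.closedSimplex s) (i : ι) => x.1.1 i) := fun x y h =>
    Subtype.ext (Subtype.ext (Finsupp.ext fun i => congrFun h i))
  have : T2Space (K.closedSimplex s) := T2Space.of_injective_continuous hinj continuous_induced_dom
  have hfin : ((Subtype.val : K.closedSimplex s → K.Realization) ⁻¹' C).Finite := by
    refine Set.Finite.of_finite_image ((hC s hs).subset ?_) Subtype.val_injective.injOn
    rintro _ ⟨x, hx, rfl⟩
    exact ⟨hx, x.2⟩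
  exact hfin.isClosed

/-- A convergent sequence meets only finitely many open simplices. -/
theorem finite_range_support_of_tendsto {x : ℕ → K.Realization} {a : K.Realization}
    (h : Filter.Tendsto x Filter.atTop (nhds a)) :
    (Set.range fun n => (x n).1.support).Finite := by
  -- `C` picks one point of the sequence in every open simplex it meets, except that of `a`.
  let I : Set (Finset ι) := (Set.range fun n => (x n).1.support) \ {a.1.support}
  have hI : ∀ s : I, ∃ n, (x n).1.support = s.1 := fun s => s.2.1
  choose n hn using hI
  let C : Set K.Realization := Set.range fun s : I => x (n s)
  have hinj : Set.InjOn (fun y : K.Realization => y.1.support) C := by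
    rintro _ ⟨s, rfl⟩ _ ⟨t, rfl⟩ hst
    simp only [hn] at hst
    rw [Subtype.ext hst]
  have hC : IsClosed C := by
    refine isClosed_of_finite_inter_closedSimplex fun t _ => ?_
    refine Set.Finite.of_finite_image (f := fun y : K.Realization => y.1.support)
      ((t.powerset.finite_toSet).subset ?_) (hinj.mono Set.inter_subset_left)
    rintro _ ⟨y, hy, rfl⟩
    exact Finset.mem_coe.2 (Finset.mem_powerset.2 hy.2)
  have haC : a ∉ C := by
    rintro ⟨s, hs⟩
    exact s.2.2 (by rw [← hs]; exact (hn s).symm)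
  obtain ⟨M, hM⟩ := Filter.eventually_atTop.1 (h.eventually (hC.isOpen_compl.mem_nhds haC))
  have hCfin : C.Finite := by
    refine ((Finset.range M).finite_toSet.image x).subset ?_
    rintro _ ⟨s, rfl⟩
    refine ⟨n s, ?_, rfl⟩
    by_contra hlt
    exact hM (n s) (by simpa using hlt) ⟨s, rfl⟩
  have hIfin : I.Finite := by
    refine (hCfin.image fun y => y.1.support).subset ?_
    intro s hs
    exact ⟨_, ⟨⟨s, hs⟩, rfl⟩, hn ⟨s, hs⟩⟩
  exact (hIfin.union (Set.finite_singleton _)).subset fun s hs => by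
    by_cases hsa : s = a.1.support
    · exact Or.inr hsa
    · exact Or.inl ⟨hs, hsa⟩

theorem sum_eq_one_of_support_subset (x : K.Realization) {s : Finset ι}
    (hs : x.1.support ⊆ s) : ∑ i ∈ s, x.1 i = 1 := by
  exact (Finset.sum_subset hs fun i _ hi => Finsupp.notMem_support_iff.1 hi).symm.trans x.2.2.1

/-- The closure of the open simplex of `s` contains every open simplex that it meets. -/
theorem mem_closure_openSimplex_of_support_eq {s : Finset ι} {x y : K.Realization}
    (hx : x ∈ closure (K.openSimplex s)) (hxy : y.1.support = x.1.support) :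
    y ∈ closure (K.openSimplex s) := by
  obtain ⟨b, hb⟩ : (K.openSimplex s).Nonempty := closure_nonempty_iff.1 ⟨x, hx⟩
  replace hb : b.1.support = s := hb
  have hs : s ∈ K.faces := hb ▸ b.2.2.2
  have hxs : x ∈ K.closedSimplex s :=
    closure_minimal (openSimplex_subset_closedSimplex s) (isClosed_closedSimplex s) hx
  have hys : y.1.support ⊆ s := hxy ▸ hxs
  -- `y` is the limit of the points of the segment from `y` to the interior point `b`.
  let t : ℕ → ℝ := fun n => 1 / ((n : ℝ) + 1)
  have ht0 : ∀ n, 0 < t n := fun n => Nat.one_div_pos_of_nat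
  have ht1 : ∀ n, t n ≤ 1 := fun n => by
    simpa [t] using Nat.one_div_le_one_div (α := ℝ) (Nat.zero_le n)
  let z : ℕ → ι →₀ ℝ := fun n => (1 - t n) • y.1 + t n • b.1
  have hz : ∀ n i, z n i = (1 - t n) * y.1 i + t n * b.1 i := fun n i => rfl
  have hzs : ∀ n, (z n).support = s := fun n => by
    ext i
    rw [Finsupp.mem_support_iff, hz]
    constructor
    · intro h
      by_contra hi
      have h1 : y.1 i = 0 := Finsupp.notMem_support_iff.1 fun h' => hi (hys h')
      have h2 : b.1 i = 0 := Finsupp.notMem_support_iff.1 (hb ▸ hi)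
      simp [h1, h2] at h
    · intro hi
      have h2 : 0 < b.1 i :=
        lt_of_le_of_ne (b.2.1 i) (Ne.symm (Finsupp.mem_support_iff.1 (hb ▸ hi)))
      have h1 := mul_nonneg (sub_nonneg.2 (ht1 n)) (y.2.1 i)
      have h3 := mul_pos (ht0 n) h2
      linarith
  let p : ℕ → K.Realization := fun n => ⟨z n, fun i =>
    add_nonneg (mul_nonneg (sub_nonneg.2 (ht1 n)) (y.2.1 i))
      (mul_nonneg (ht0 n).le (b.2.1 i)), by
    rw [hzs]
    simp only [hz]
    rw [Finset.sum_add_distrib, ← Finset.mul_sum, ← Finset.mul_sum,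
      sum_eq_one_of_support_subset y hys, sum_eq_one_of_support_subset b hb.subset]
    ring, by rw [hzs]; exact hs⟩
  have hp : ∀ n, p n ∈ K.closedSimplex s := fun n => (hzs n).subset
  let := K.closedSimplexTopology s
  have hlim : Filter.Tendsto (fun n => (⟨p n, hp n⟩ : K.closedSimplex s)) Filter.atTop
      (nhds ⟨y, hys⟩) := by
    rw [nhds_induced, Filter.tendsto_comap_iff, tendsto_pi_nhds]
    intro i
    change Filter.Tendsto (fun n => (1 - t n) * y.1 i + t n * b.1 i) Filter.atTop (nhds (y.1 i))
    have h0 : Filter.Tendsto t Filter.atTop (nhds 0) := tendsto_one_div_add_atTop_nhds_zero_nat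
    have := ((tendsto_const_nhds (x := (1 : ℝ))).sub h0).mul_const (y.1 i) |>.add
      (h0.mul_const (b.1 i))
    simpa using this
  have hlim' : Filter.Tendsto p Filter.atTop (nhds y) :=
    ((continuous_closedSimplex_val hs).tendsto ⟨y, hys⟩).comp hlim
  exact mem_closure_of_tendsto hlim' (Filter.Eventually.of_forall hzs)

end AbstractSimplicialComplex

/-! ### Open simplices of a triangulation -/

namespace Triangulation

variable {ι : Type*} {X : Type*} [TopologicalSpace X] (T : Triangulation ι X)

/-- The carrier of a point: the vertex set of the open simplex containing it. -/
def carrier (x : X) : Finset ι :=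
  (T.homeo.symm x).1.support

variable {T}

theorem mem_openSimplex_iff {x : X} {s : Finset ι} : x ∈ T.openSimplex s ↔ T.carrier x = s := by
  constructor
  · rintro ⟨y, hy, rfl⟩
    rw [carrier, T.homeo.symm_apply_apply]
    exact hy
  · intro h
    exact ⟨T.homeo.symm x, h, T.homeo.apply_symm_apply x⟩

theorem carrier_mem_faces (x : X) : T.carrier x ∈ T.complex.faces :=
  (T.homeo.symm x).2.2.2

theorem exists_infinite_carrier_eq {x : ℕ → X} {a : X}
    (h : Filter.Tendsto x Filter.atTop (nhds a)) : ∃ s, {n | T.carrier (x n) = s}.Infinite := by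
  have hfin : (Set.range fun n => (T.homeo.symm (x n)).1.support).Finite :=
    AbstractSimplicialComplex.finite_range_support_of_tendsto
      ((T.homeo.symm.continuous.tendsto a).comp h)
  have := hfin.to_subtype
  obtain ⟨s, hs⟩ := Finite.exists_infinite_fiber
    (Set.rangeFactorization fun n => (T.homeo.symm (x n)).1.support)
  refine ⟨s.1, (Set.infinite_coe_iff.1 hs).mono fun n hn => ?_⟩
  exact congrArg Subtype.val hn

/-- If `x n → a`, then some open simplex containing a point `x n` has all the points of the open
simplex of `a` in its closure. -/
theorem exists_mem_closure_openSimplex {x : ℕ → X} {a b : X}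
    (h : Filter.Tendsto x Filter.atTop (nhds a)) (hab : T.carrier b = T.carrier a) :
    ∃ n, b ∈ closure (T.openSimplex (T.carrier (x n))) := by
  obtain ⟨s, hs⟩ := exists_infinite_carrier_eq (T := T) h
  obtain ⟨n, hn⟩ := hs.nonempty
  refine ⟨n, ?_⟩
  rw [hn, openSimplex, ← T.homeo.image_closure]
  refine ⟨T.homeo.symm b, ?_, T.homeo.apply_symm_apply b⟩
  refine AbstractSimplicialComplex.mem_closure_openSimplex_of_support_eq
    (x := T.homeo.symm a) ?_ hab
  refine mem_closure_of_frequently_of_tendsto ?_ ((T.homeo.symm.continuous.tendsto a).comp h)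
  exact Nat.frequently_atTop_iff_infinite.2 hs

theorem RefinesOrientedStratification.isTame {k : ℕ} {T : Triangulation ι (InfGrassmannian k)}
    (hT : T.RefinesOrientedStratification) : T.IsTame := by
  intro s _ V hV W hW v hv
  obtain ⟨F, -, hF⟩ := hT V
  have hVF : V ∈ ⋃ s ∈ F, T.openSimplex s := hF ▸ (rfl : V.covectors = V.covectors)
  obtain ⟨s', hs', hVs'⟩ := Set.mem_iUnion₂.1 hVF
  have hss' : s' = s := (mem_openSimplex_iff.1 hVs').symm.trans (mem_openSimplex_iff.1 hV)
  have hWV : W ∈ V.orientedStratum := hF ▸ Set.mem_iUnion₂.2 ⟨s, hss' ▸ hs', hW⟩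
  have hmem : (fun i => SignType.sign (v i)) ∈ W.covectors := by
    rw [show W.covectors = V.covectors from hWV]
    exact ⟨v, hv, fun _ => rfl⟩
  obtain ⟨w, hw, hvw⟩ := hmem
  exact ⟨w, hw, fun i => by
    rw [← sign_eq_zero_iff, show SignType.sign (v i) = _ from hvw i, sign_eq_zero_iff]⟩

end Triangulation

/-! ### Continuous families and closed conditions in the infinite Grassmannian -/

namespace InfGrassmannian

variable {k : ℕ}

/-- The range of an injective linear map `ℝᵏ → ℝ^∞`, as a point of `G(k, ℝ^∞)`. -/
noncomputable def ofInjective (φ : (Fin k → ℝ) →ₗ[ℝ] (ℕ →₀ ℝ)) (hφ : Function.Injective φ) :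
    InfGrassmannian k :=
  ⟨LinearMap.range φ, inferInstance, by simpa using LinearMap.finrank_range_of_inj hφ⟩

theorem continuous_toInf (n : ℕ) :
    Continuous (FinGrassmannian.toInf : FinGrassmannian k n → InfGrassmannian k) :=
  continuous_iSup_rng (i := n) continuous_coinduced_rng

theorem coordInclusion_apply_fin {n : ℕ} (x : Fin n → ℝ) (i : Fin n) :
    coordInclusion n x i = x i := by
  exact Finsupp.mapDomain_apply Fin.val_injective
    ((Finsupp.linearEquivFunOnFinite ℝ ℝ (Fin n)).symm x) i

theorem coordInclusion_apply_of_le {n i : ℕ} (x : Fin n → ℝ) (hi : n ≤ i) :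
    coordInclusion n x i = 0 := by
  refine Finsupp.mapDomain_of_notMem_range _ _ ?_
  rintro ⟨j, rfl⟩
  exact absurd j.2 (not_lt.2 hi)

theorem continuous_coordInclusion_apply (n i : ℕ) :
    Continuous fun x : Fin n → ℝ => coordInclusion n x i := by
  by_cases hi : i < n
  · simpa only [coordInclusion_apply_fin _ ⟨i, hi⟩] using continuous_apply (⟨i, hi⟩ : Fin n)
  · simpa only [coordInclusion_apply_of_le _ (not_lt.1 hi)] using continuous_const

/-- A family of injective linear maps into a fixed `ℝⁿ ⊆ ℝ^∞` whose matrix entries are continuous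
has continuously varying range. -/
theorem continuous_ofInjective {S : Type*} [TopologicalSpace S] (n : ℕ)
    (φ : S → (Fin k → ℝ) →ₗ[ℝ] (ℕ →₀ ℝ)) (hφ : ∀ s, Function.Injective (φ s))
    (hn : ∀ s g i, n ≤ i → φ s g i = 0) (hc : ∀ g i, Continuous fun s => φ s g i) :
    Continuous fun s => ofInjective (φ s) (hφ s) := by
  let b : S → Fin k → Fin n → ℝ := fun s r i => φ s (Pi.single r 1) i
  have hb : ∀ s r, coordInclusion n (b s r) = φ s (Pi.single r 1) := fun s r => by
    ext i
    by_cases hi : i < n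
    · exact coordInclusion_apply_fin _ ⟨i, hi⟩
    · rw [coordInclusion_apply_of_le _ (not_lt.1 hi), hn _ _ _ (not_lt.1 hi)]
  have hli : ∀ s, LinearIndependent ℝ (b s) := fun s => by
    refine LinearIndependent.of_comp (coordInclusion n) ?_
    have h := (Pi.basisFun ℝ (Fin k)).linearIndependent.map' (φ s) (LinearMap.ker_eq_bot.2 (hφ s))
    have hcomp : coordInclusion n ∘ b s = φ s ∘ Pi.basisFun ℝ (Fin k) := by
      funext r
      simpa using hb s r
    rw [hcomp]
    exact h
  have hcont : Continuous fun s => (⟨b s, hli s⟩ : LinIndepFrame k n) :=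
    Continuous.subtype_mk (continuous_pi fun r => continuous_pi fun i => hc _ _) _
  have hspan : Continuous (LinIndepFrame.span : LinIndepFrame k n → FinGrassmannian k n) :=
    continuous_coinduced_rng
  have heq : (fun s => ofInjective (φ s) (hφ s)) = fun s =>
      (LinIndepFrame.span (⟨b s, hli s⟩ : LinIndepFrame k n)).toInf := by
    funext s
    refine Subtype.ext ?_
    change LinearMap.range (φ s) = (Submodule.span ℝ (Set.range (b s))).map (coordInclusion n)
    rw [Submodule.map_span, ← Set.range_comp, LinearMap.range_eq_map,
      ← (Pi.basisFun ℝ (Fin k)).span_eq, Submodule.map_span, ← Set.range_comp]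
    congr 2
    funext r
    simpa using (hb s r).symm
  rw [heq]
  exact (continuous_toInf n).comp (hspan.comp hcont)

/-- If `F` is continuous on every `ℝⁿ`, then the `k`-planes on all of whose pairs of vectors `F`
vanishes form a closed set. -/
theorem isClosed_forall_mem_forall_mem_eq_zero (F : (ℕ →₀ ℝ) → (ℕ →₀ ℝ) → ℝ)
    (hF : ∀ n, Continuous fun p : (Fin n → ℝ) × (Fin n → ℝ) =>
      F (coordInclusion n p.1) (coordInclusion n p.2)) :
    IsClosed {W : InfGrassmannian k | ∀ u ∈ W.1, ∀ v ∈ W.1, F u v = 0} := by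
  refine isClosed_iSup_iff.2 fun n => isClosed_coinduced.2 (isClosed_coinduced.2 ?_)
  have heq : (LinIndepFrame.span (k := k) (n := n) ⁻¹' (FinGrassmannian.toInf ⁻¹'
      {W : InfGrassmannian k | ∀ u ∈ W.1, ∀ v ∈ W.1, F u v = 0})) =
      ⋂ α : Fin k → ℝ, ⋂ β : Fin k → ℝ, {b : LinIndepFrame k n |
        F (coordInclusion n (∑ r, α r • b.1 r)) (coordInclusion n (∑ r, β r • b.1 r)) = 0} := by
    ext b
    simp only [Set.mem_iInter]
    change (∀ u ∈ (Submodule.span ℝ (Set.range b.1)).map (coordInclusion n),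
      ∀ v ∈ (Submodule.span ℝ (Set.range b.1)).map (coordInclusion n), F u v = 0) ↔
      ∀ α β : Fin k → ℝ,
        F (coordInclusion n (∑ r, α r • b.1 r)) (coordInclusion n (∑ r, β r • b.1 r)) = 0
    constructor
    · intro h α β
      exact h _ ⟨_, (Submodule.mem_span_range_iff_exists_fun ℝ).2 ⟨α, rfl⟩, rfl⟩ _
        ⟨_, (Submodule.mem_span_range_iff_exists_fun ℝ).2 ⟨β, rfl⟩, rfl⟩
    · rintro h _ ⟨u, hu, rfl⟩ _ ⟨v, hv, rfl⟩
      obtain ⟨α, rfl⟩ := (Submodule.mem_span_range_iff_exists_fun ℝ).1 hu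
      obtain ⟨β, rfl⟩ := (Submodule.mem_span_range_iff_exists_fun ℝ).1 hv
      exact h α β
  rw [heq]
  refine isClosed_iInter fun α => isClosed_iInter fun β => isClosed_eq ?_ continuous_const
  refine (hF n).comp (f := fun b : LinIndepFrame k n =>
    (∑ r, α r • b.1 r, ∑ r, β r • b.1 r)) ?_
  have h : ∀ r, Continuous fun b : LinIndepFrame k n => b.1 r := fun r =>
    (continuous_apply r).comp continuous_subtype_val
  exact (continuous_finsetSum Finset.univ fun r _ => (h r).const_smul (α r)).prodMk
    (continuous_finsetSum Finset.univ fun r _ => (h r).const_smul (β r))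

/-- The `2 × 2` minor with rows `u`, `v` and columns `a`, `b`. -/
noncomputable def minor (u v : ℕ →₀ ℝ) (a b : ℕ) : ℝ :=
  u a * v b - u b * v a

/-- The `k`-planes on which `c · [02][13] = [03][12]` for the `2 × 2` minors of any two vectors: if
the coordinate functionals `0, 1, 2, 3` are pairwise independent and span a plane, then this says
that their cross-ratio is `c`. Quantifying over all pairs of vectors, rather than over bases,
makes it a closed condition on every `k`-plane. -/
def crossRatioLocus (k : ℕ) (c : ℝ) : Set (InfGrassmannian k) :=
  {W | ∀ u ∈ W.1, ∀ v ∈ W.1,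
    c * (minor u v 0 2 * minor u v 1 3) - minor u v 0 3 * minor u v 1 2 = 0}

theorem isClosed_crossRatioLocus (c : ℝ) : IsClosed (crossRatioLocus k c) := by
  refine isClosed_forall_mem_forall_mem_eq_zero
    (fun u v => c * (minor u v 0 2 * minor u v 1 3) - minor u v 0 3 * minor u v 1 2) fun n => ?_
  have h1 : ∀ i, Continuous fun p : (Fin n → ℝ) × (Fin n → ℝ) => coordInclusion n p.1 i :=
    fun i => (continuous_coordInclusion_apply n i).comp continuous_fst
  have h2 : ∀ i, Continuous fun p : (Fin n → ℝ) × (Fin n → ℝ) => coordInclusion n p.2 i :=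
    fun i => (continuous_coordInclusion_apply n i).comp continuous_snd
  have h3 : ∀ a b, Continuous fun p : (Fin n → ℝ) × (Fin n → ℝ) =>
      minor (coordInclusion n p.1) (coordInclusion n p.2) a b :=
    fun a b => ((h1 a).mul (h2 b)).sub ((h1 b).mul (h2 a))
  exact (continuous_const.mul ((h3 0 2).mul (h3 1 3))).sub ((h3 0 3).mul (h3 1 2))

end InfGrassmannian

/-! ### A chain of incidences that prescribes a cross-ratio -/

section Functionals

variable {M : Type*} [AddCommGroup M] [Module ℝ M]

theorem exists_eq_mul_of_ker_le {f h : M →ₗ[ℝ] ℝ} (H : ∀ w, f w = 0 → h w = 0) :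
    ∃ α, ∀ w, h w = α * f w := by
  have hmem : h ∈ Submodule.span ℝ (Set.range fun _ : Unit => f) :=
    mem_span_of_iInf_ker_le_ker fun w hw => H w (by simpa using hw)
  obtain ⟨c, hc⟩ := (Submodule.mem_span_range_iff_exists_fun ℝ).1 hmem
  exact ⟨c (), fun w => by simp [← hc]⟩

theorem exists_eq_add_of_ker_inf_le {f g h : M →ₗ[ℝ] ℝ} (H : ∀ w, f w = 0 → g w = 0 → h w = 0) :
    ∃ α β, ∀ w, h w = α * f w + β * g w := by
  have hmem : h ∈ Submodule.span ℝ (Set.range ![f, g]) := by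
    refine mem_span_of_iInf_ker_le_ker fun w hw => ?_
    rw [Submodule.mem_iInf] at hw
    exact H w (hw 0) (hw 1)
  obtain ⟨c, hc⟩ := (Submodule.mem_span_range_iff_exists_fun ℝ).1 hmem
  exact ⟨c 0, c 1, fun w => by simp [← hc, Fin.sum_univ_two]⟩

/-- Projectively, `Z` is an origin, `X` and `Y` are the points at infinity of the two axes, and `D`
is a third point at infinity. The parallel projection `A j ↦ B j ↦ A (j + 1)` from the line
`ZX` to a parallel of it and back, first along `Y` and then along `D`, is a translation, so `A j`
is `j` times as far from `Z` as `A 1`. The conclusion says, with denominators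
cleared, that `N` is the cross-ratio of `Z, X, P, Q`, where `P` and `Q` are multiples of `A 1` and
`A N`. -/
theorem crossRatio_eq_of_translation_chain (Z X Y D P Q : M →ₗ[ℝ] ℝ) (A B : ℕ → M →ₗ[ℝ] ℝ) (N : ℕ)
    (hZ : ∃ w, Z w ≠ 0 ∧ X w = 0 ∧ Y w = 0) (hX : ∃ w, X w ≠ 0 ∧ Z w = 0 ∧ Y w = 0)
    (hY : ∃ w, Y w ≠ 0 ∧ Z w = 0 ∧ X w = 0)
    (hD : ∀ w, X w = 0 → Y w = 0 → D w = 0) (hDX : ∃ w, X w = 0 ∧ D w ≠ 0)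
    (hA0 : ∀ w, Z w = 0 → A 0 w = 0) (hA1 : ∃ w, X w = 0 ∧ A 1 w ≠ 0)
    (hA : ∀ j ≤ N + 1, ∀ w, Z w = 0 → X w = 0 → A j w = 0)
    (hB : ∀ j ≤ N, ∀ w, A j w = 0 → Y w = 0 → B j w = 0)
    (hBX : ∀ j ≤ N, ∀ w, B 0 w = 0 → X w = 0 → B j w = 0)
    (hAB : ∀ j ≤ N, ∀ w, B j w = 0 → D w = 0 → A (j + 1) w = 0)
    (hP : ∀ w, A 1 w = 0 → P w = 0) (hQ : ∀ w, A N w = 0 → Q w = 0) (u v : M) :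
    N * ((Z u * P v - P u * Z v) * (X u * Q v - Q u * X v)) -
      (Z u * Q v - Q u * Z v) * (X u * P v - P u * X v) = 0 := by
  have hind : ∀ {a b c a' b' c' : ℝ}, (∀ w, a * Z w + b * X w + c * Y w =
      a' * Z w + b' * X w + c' * Y w) → a = a' ∧ b = b' ∧ c = c' := by
    intro a b c a' b' c' h
    obtain ⟨z, hz, hz1, hz2⟩ := hZ
    obtain ⟨x, hx, hx1, hx2⟩ := hX
    obtain ⟨y, hy, hy1, hy2⟩ := hY
    have h1 := h z
    have h2 := h x
    have h3 := h y
    simp only [hz1, hz2, hx1, hx2, hy1, hy2, mul_zero, add_zero, zero_add] at h1 h2 h3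
    exact ⟨mul_right_cancel₀ hz h1, mul_right_cancel₀ hx h2, mul_right_cancel₀ hy h3⟩
  obtain ⟨γ, δ, hD⟩ := exists_eq_add_of_ker_inf_le hD
  have hδ : δ ≠ 0 := by
    rintro rfl
    obtain ⟨w, hw, hw'⟩ := hDX
    exact hw' (by simp [hD, hw])
  obtain ⟨α₀, hA0⟩ := exists_eq_mul_of_ker_le hA0
  obtain ⟨a, b, hA1'⟩ := exists_eq_add_of_ker_inf_le (hA 1 (by omega))
  have ha : a ≠ 0 := by
    rintro rfl
    obtain ⟨w, hw, hw'⟩ := hA1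
    exact hw' (by simp [hA1', hw])
  obtain ⟨p', q, hB0'⟩ := exists_eq_add_of_ker_inf_le (hB 0 (by omega))
  obtain ⟨p, hB0⟩ : ∃ p, ∀ w, B 0 w = p * Z w + q * Y w :=
    ⟨p' * α₀, fun w => by rw [hB0', hA0]; ring⟩
  obtain ⟨ρ, σ, hAB0⟩ := exists_eq_add_of_ker_inf_le (hAB 0 (by omega))
  obtain ⟨e1, e2, e3⟩ := hind (a := a) (b := b) (c := 0) (a' := ρ * p) (b' := σ * γ)
    (c' := ρ * q + σ * δ) fun w => by
      have := hAB0 w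
      rw [zero_add, hA1', hB0, hD] at this
      linear_combination this
  have hρ : ρ ≠ 0 := by
    rintro rfl
    exact ha (by simpa using e1)
  -- After rescaling `Z` by `a` and `X` by `b`, `A j` is a multiple (possibly zero) of `Z + j X`.
  have key : ∀ j ≤ N + 1, ∃ s, ∀ w, A j w = s * (a * Z w + j * b * X w) := by
    intro j
    induction j with
    | zero => exact fun _ => ⟨α₀ / a, fun w => by rw [hA0]; push_cast; field_simp; ring⟩
    | succ j ih =>
      intro hj
      obtain ⟨s, hs⟩ := ih (by omega)
      obtain ⟨α, β, h1⟩ := exists_eq_add_of_ker_inf_le (hB j (by omega))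
      obtain ⟨α', β', h2⟩ := exists_eq_add_of_ker_inf_le (hBX j (by omega))
      obtain ⟨μ, ν, h3⟩ := exists_eq_add_of_ker_inf_le (hAB j (by omega))
      obtain ⟨κ, ξ, h4⟩ := exists_eq_add_of_ker_inf_le (hA (j + 1) hj)
      obtain ⟨f1, -, f3⟩ := hind (a := α * s * a) (b := α * s * j * b) (c := β) (a' := α' * p)
        (b' := β') (c' := α' * q) fun w => by
          have := h1 w
          rw [h2, hB0, hs] at this
          linear_combination -this
      obtain ⟨-, -, g3⟩ := hind (a := κ) (b := ξ) (c := 0) (a' := μ * α * s * a)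
        (b' := μ * α * s * j * b + ν * γ) (c' := μ * β + ν * δ) fun w => by
          have := h4 w
          rw [h3, h1, hs, hD] at this
          linear_combination -this
      have f4 : ρ * (α * s) = α' := by
        refine mul_right_cancel₀ ha ?_
        linear_combination ρ * f1 - α' * e1
      have f5 : ν = μ * σ * (α * s) := by
        refine mul_right_cancel₀ hδ (mul_left_cancel₀ hρ ?_)
        linear_combination -ρ * g3 - μ * ρ * f3 + μ * α' * e3 - μ * σ * δ * f4
      refine ⟨μ * α * s, fun w => ?_⟩
      rw [h3, h1, hs, hD, f5, e2]
      push_cast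
      linear_combination -(Y w) * (g3 + δ * f5)
  obtain ⟨π, hP⟩ := exists_eq_mul_of_ker_le hP
  obtain ⟨θ, hQ⟩ := exists_eq_mul_of_ker_le hQ
  obtain ⟨s, hs⟩ := key N (by omega)
  simp only [hP, hQ, hs, hA1']
  ring

end Functionals

/-! ### The configurations -/

namespace InfGrassmannian

/-- The coordinates of the vector with parameters `g` in the `(m + 3)`-plane `chainPlane m L ε t`.
With `Z, X, Y` the first three coordinates of `g`, the coordinate functionals are
`Z`, `X`, `Z + X`, `ε Z + X`, `X - Y`, then `Y` and the remaining coordinates of `g`, and finally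
`t (Z + j X)` and `t (Z + j X + Y)` alternatingly for `j < L`. -/
noncomputable def chainCoord (m L : ℕ) (ε t : ℝ) (g : Fin (m + 3) → ℝ) : ℕ → ℝ
  | 0 => g 0
  | 1 => g 1
  | 2 => g 0 + g 1
  | 3 => ε * g 0 + g 1
  | 4 => g 1 - g 2
  | i + 5 =>
    if h : i < m + 1 then g ⟨i + 2, by omega⟩
    else if i < m + 1 + 2 * L then
      t * (g 0 + ((i - (m + 1)) / 2 : ℕ) * g 1 + if (i - (m + 1)) % 2 = 0 then 0 else g 2)
    else 0

variable {m L : ℕ} {ε t : ℝ}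

theorem chainCoord_add_five (g : Fin (m + 3) → ℝ) {i : ℕ} (hi : i < m + 1) :
    chainCoord m L ε t g (i + 5) = g ⟨i + 2, by omega⟩ := by
  simp [chainCoord, hi]

theorem chainCoord_five (g : Fin (m + 3) → ℝ) : chainCoord m L ε t g 5 = g 2 :=
  chainCoord_add_five g (Nat.succ_pos m)

theorem chainCoord_even (g : Fin (m + 3) → ℝ) {j : ℕ} (hj : j < L) :
    chainCoord m L ε t g (m + 6 + 2 * j) = t * (g 0 + j * g 1) := by
  have h1 : m + 1 + 2 * j < m + 1 + 2 * L := by omega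
  rw [show m + 6 + 2 * j = (m + 1 + 2 * j) + 5 by omega]
  simp [chainCoord, hj, show ¬ (m + 1 + 2 * j < m + 1) by omega]

theorem chainCoord_odd (g : Fin (m + 3) → ℝ) {j : ℕ} (hj : j < L) :
    chainCoord m L ε t g (m + 7 + 2 * j) = t * (g 0 + j * g 1 + g 2) := by
  have h1 : m + 1 + (2 * j + 1) < m + 1 + 2 * L := by omega
  rw [show m + 7 + 2 * j = (m + 1 + (2 * j + 1)) + 5 by omega]
  simp only [chainCoord]
  rw [dif_neg (by omega), if_pos h1, if_neg (by omega)]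
  congr 5
  omega

theorem chainCoord_of_le (g : Fin (m + 3) → ℝ) {i : ℕ} (hi : m + 6 + 2 * L ≤ i) :
    chainCoord m L ε t g i = 0 := by
  obtain ⟨i, rfl⟩ : ∃ i', i = i' + 5 := ⟨i - 5, by omega⟩
  simp only [chainCoord]
  rw [dif_neg (by omega), if_neg (by omega)]

/-- For `t = 0` the auxiliary coordinates vanish, so their number does not matter. -/
theorem chainCoord_zero_right (g : Fin (m + 3) → ℝ) :
    chainCoord m L ε 0 g = chainCoord m 0 ε 0 g := by
  funext i
  rcases i with _ | _ | _ | _ | _ | i <;> simp [chainCoord]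

theorem chainCoord_add (g g' : Fin (m + 3) → ℝ) (i : ℕ) :
    chainCoord m L ε t (g + g') i = chainCoord m L ε t g i + chainCoord m L ε t g' i := by
  rcases i with _ | _ | _ | _ | _ | i <;> simp only [chainCoord, Pi.add_apply] <;>
    (try split_ifs) <;> ring

theorem chainCoord_smul (c : ℝ) (g : Fin (m + 3) → ℝ) (i : ℕ) :
    chainCoord m L ε t (c • g) i = c * chainCoord m L ε t g i := by
  rcases i with _ | _ | _ | _ | _ | i <;> simp only [chainCoord, Pi.smul_apply, smul_eq_mul] <;>
    (try split_ifs) <;> ring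

/-- `chainCoord` as a linear map `ℝᵐ⁺³ → ℝ^∞`. -/
noncomputable def chainMap (m L : ℕ) (ε t : ℝ) : (Fin (m + 3) → ℝ) →ₗ[ℝ] (ℕ →₀ ℝ) where
  toFun g := Finsupp.onFinset (Finset.range (m + 6 + 2 * L)) (chainCoord m L ε t g) fun i hi => by
    by_contra h
    exact hi (chainCoord_of_le g (by simpa using h))
  map_add' g g' := Finsupp.ext fun i => chainCoord_add g g' i
  map_smul' c g := Finsupp.ext fun i => chainCoord_smul c g i

theorem chainMap_apply (g : Fin (m + 3) → ℝ) (i : ℕ) :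
    chainMap m L ε t g i = chainCoord m L ε t g i :=
  rfl

theorem chainMap_injective (m L : ℕ) (ε t : ℝ) : Function.Injective (chainMap m L ε t) := by
  intro g g' h
  have h' : ∀ i, chainCoord m L ε t g i = chainCoord m L ε t g' i := fun i => DFunLike.congr_fun h i
  funext ⟨r, hr⟩
  rcases r with _ | _ | r
  · exact h' 0
  · exact h' 1
  · simpa only [chainCoord_add_five _ (show r < m + 1 by omega)] using h' (r + 5)

/-- The plane whose vectors are the `chainCoord m L ε t g`. For `ε = 1 / N`, `N + 2 ≤ L` and `t ≠ 0` its
coordinate functionals contain a chain as in `crossRatio_eq_of_translation_chain`. -/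
noncomputable def chainPlane (m L : ℕ) (ε t : ℝ) : InfGrassmannian (m + 3) :=
  ofInjective (chainMap m L ε t) (chainMap_injective m L ε t)

theorem chainPlane_zero_right : chainPlane m L ε 0 = chainPlane m 0 ε 0 := by
  have h : chainMap m L ε 0 = chainMap m 0 ε 0 :=
    LinearMap.ext fun g => Finsupp.ext fun i => congrFun (chainCoord_zero_right g) i
  refine Subtype.ext ?_
  change LinearMap.range _ = LinearMap.range _
  rw [h]

theorem continuous_chainPlane (m L : ℕ) :
    Continuous fun s : ℝ × ℝ => chainPlane m L s.1 s.2 := by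
  refine continuous_ofInjective (m + 6 + 2 * L) _ _ (fun s g i hi => chainCoord_of_le g hi)
    fun g i => ?_
  simp only [chainMap_apply]
  rcases i with _ | _ | _ | _ | _ | i <;> simp only [chainCoord] <;> (try split_ifs) <;> fun_prop

theorem tendsto_chainPlane (m L : ℕ) {ε t : ℕ → ℝ} {ε₀ t₀ : ℝ}
    (hε : Filter.Tendsto ε Filter.atTop (𝓝 ε₀)) (ht : Filter.Tendsto t Filter.atTop (𝓝 t₀)) :
    Filter.Tendsto (fun n => chainPlane m L (ε n) (t n)) Filter.atTop
      (𝓝 (chainPlane m L ε₀ t₀)) := by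
  have h := (continuous_chainPlane m L).tendsto (ε₀, t₀)
  exact Filter.Tendsto.comp (f := fun n => (ε n, t n)) h (hε.prodMk_nhds ht)

/-- The cross-ratio of the coordinate functionals `Z`, `X`, `Z + X`, `ε Z + X` is `1 / ε`. -/
theorem eq_of_chainPlane_mem_crossRatioLocus {c : ℝ}
    (h : chainPlane m L ε t ∈ crossRatioLocus (m + 3) c) : c * ε = 1 := by
  have h1 := h (chainMap m L ε t (Pi.single 0 1)) ⟨_, rfl⟩ (chainMap m L ε t (Pi.single 1 1))
    ⟨_, rfl⟩
  simp [minor, chainMap_apply, chainCoord] at h1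
  linarith

/-- The vanishing patterns of the vectors of `chainPlane` determine a cross-ratio: any plane with
the same patterns lies in `crossRatioLocus`. -/
theorem mem_crossRatioLocus_of_zeros_eq {N : ℕ} (hN : 0 < N) (ht : t ≠ 0)
    {W : InfGrassmannian (m + 3)}
    (h₁ : ∀ w ∈ W.1, ∃ v ∈ (chainPlane m (N + 2) (1 / N) t).1, ∀ i, w i = 0 ↔ v i = 0)
    (h₂ : ∀ v ∈ (chainPlane m (N + 2) (1 / N) t).1, ∃ w ∈ W.1, ∀ i, v i = 0 ↔ w i = 0) :
    W ∈ crossRatioLocus (m + 3) N := by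
  have hN' : (N : ℝ) ≠ 0 := by exact_mod_cast hN.ne'
  let c : (Fin (m + 3) → ℝ) → ℕ → ℝ := chainCoord m (N + 2) (1 / N) t
  have c0 : ∀ g, c g 0 = g 0 := fun g => rfl
  have c1 : ∀ g, c g 1 = g 1 := fun g => rfl
  have c2 : ∀ g, c g 2 = g 0 + g 1 := fun g => rfl
  have c3 : ∀ g, c g 3 = 1 / N * g 0 + g 1 := fun g => rfl
  have c4 : ∀ g, c g 4 = g 1 - g 2 := fun g => rfl
  have c5 : ∀ g, c g 5 = g 2 := chainCoord_five
  have cA : ∀ g, ∀ j ≤ N + 1, c g (m + 6 + 2 * j) = t * (g 0 + j * g 1) :=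
    fun g j hj => chainCoord_even g (by omega)
  have cB : ∀ g, ∀ j ≤ N + 1, c g (m + 7 + 2 * j) = t * (g 0 + j * g 1 + g 2) :=
    fun g j hj => chainCoord_odd g (by omega)
  have z₁ : ∀ w : W.1, ∃ g, ∀ i, w.1 i = 0 ↔ c g i = 0 := by
    rintro ⟨w, hw⟩
    obtain ⟨_, ⟨g, rfl⟩, hg⟩ := h₁ w hw
    exact ⟨g, hg⟩
  have z₂ : ∀ g, ∃ w : W.1, ∀ i, w.1 i = 0 ↔ c g i = 0 := by
    intro g
    obtain ⟨w, hw, hg⟩ := h₂ _ ⟨g, rfl⟩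
    exact ⟨⟨w, hw⟩, fun i => (hg i).symm⟩
  -- Incidences between coordinate functionals hold on `W` once they hold on `chainPlane`.
  have dep : ∀ {a b d : ℕ}, (∀ g, c g a = 0 → c g b = 0 → c g d = 0) →
      ∀ w : W.1, w.1 a = 0 → w.1 b = 0 → w.1 d = 0 := by
    intro a b d h w ha hb
    obtain ⟨g, hg⟩ := z₁ w
    exact (hg d).2 (h g ((hg a).1 ha) ((hg b).1 hb))
  let x : ℕ → W.1 →ₗ[ℝ] ℝ := fun i => Finsupp.lapply i ∘ₗ W.1.subtype
  obtain ⟨wz, hwz⟩ := z₂ (Pi.single 0 1)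
  obtain ⟨wx, hwx⟩ := z₂ (Pi.single 1 1)
  obtain ⟨wy, hwy⟩ := z₂ (Pi.single 2 1)
  have s20 : (2 : Fin (m + 3)) ≠ 0 := Fin.ne_of_val_ne (by rw [Fin.val_two]; simp)
  have s21 : (2 : Fin (m + 3)) ≠ 1 := Fin.ne_of_val_ne (by rw [Fin.val_two]; simp)
  intro u hu v hv
  have hsingle : ∀ {w : W.1} {r : Fin (m + 3)},
      (∀ i, w.1 i = 0 ↔ c (Pi.single r 1) i = 0) → ∀ {i}, c (Pi.single r 1) i = 0 → x i w = 0 :=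
    fun h _ => (h _).2
  have hsingle' : ∀ {w : W.1} {r : Fin (m + 3)},
      (∀ i, w.1 i = 0 ↔ c (Pi.single r 1) i = 0) → ∀ {i}, c (Pi.single r 1) i ≠ 0 → x i w ≠ 0 :=
    fun h _ => mt (h _).1
  have hAz : ∀ g, ∀ j ≤ N + 1, c g (m + 6 + 2 * j) = 0 ↔ g 0 + j * g 1 = 0 := fun g j hj => by
    rw [cA g j hj, mul_eq_zero, or_iff_right ht]
  have hBz : ∀ g, ∀ j ≤ N + 1, c g (m + 7 + 2 * j) = 0 ↔ g 0 + j * g 1 + g 2 = 0 :=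
    fun g j hj => by rw [cB g j hj, mul_eq_zero, or_iff_right ht]
  refine crossRatio_eq_of_translation_chain (x 0) (x 1) (x 5) (x 4) (x 2) (x 3)
    (fun j => x (m + 6 + 2 * j)) (fun j => x (m + 7 + 2 * j)) N
    ⟨wz, hsingle' hwz (by simp [c0]), hsingle hwz (by simp [c1]), hsingle hwz (by simp [c5, s20])⟩
    ⟨wx, hsingle' hwx (by simp [c1]), hsingle hwx (by simp [c0]), hsingle hwx (by simp [c5, s21])⟩
    ⟨wy, hsingle' hwy (by simp [c5]), hsingle hwy (by simp [c0, s20.symm]),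
      hsingle hwy (by simp [c1, s21.symm])⟩
    (dep fun g h h' => ?_) ⟨wy, hsingle hwy (by simp [c1, s21.symm]),
      hsingle' hwy (by simp [c4, s21.symm])⟩
    (fun w h => dep (fun g h _ => ?_) w h h)
    ⟨wz, hsingle hwz (by simp [c1]), hsingle' hwz (mt (hAz _ 1 (by omega)).1 (by simp))⟩
    (fun j hj => dep fun g h h' => ?_) (fun j hj => dep fun g h h' => ?_)
    (fun j hj => dep fun g h h' => ?_) (fun j hj => dep fun g h h' => ?_)
    (fun w h => dep (fun g h _ => ?_) w h h) (fun w h => dep (fun g h _ => ?_) w h h) ⟨u, hu⟩ ⟨v, hv⟩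
  · rw [c1] at h
    rw [c5] at h'
    rw [c4, h, h', sub_zero]
  · rw [c0] at h
    rw [hAz g 0 (by omega), h]
    simp
  · rw [c0] at h
    rw [c1] at h'
    rw [hAz g j hj, h, h']
    simp
  · rw [hAz g j (by omega)] at h
    rw [c5] at h'
    rw [hBz g j (by omega), h, h', add_zero]
  · rw [hBz g 0 (by omega), Nat.cast_zero, zero_mul, add_zero] at h
    rw [c1] at h'
    rw [hBz g j (by omega), h']
    linear_combination h
  · rw [hBz g j (by omega)] at h
    rw [c4] at h'
    rw [hAz g (j + 1) (by omega)]
    push_cast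
    linear_combination h + h'
  · rw [hAz g 1 (by omega)] at h
    rw [c2]
    linear_combination h
  · rw [hAz g N (by omega)] at h
    rw [c3]
    field_simp
    linear_combination h

end InfGrassmannian

/-! ### Nonexistence of tame triangulations -/

namespace Triangulation

variable {ι : Type*}

theorem not_isTame {m : ℕ} (T : Triangulation ι (InfGrassmannian (m + 3))) : ¬ T.IsTame := by
  intro hT
  let e : ℕ → ℝ := fun n => 1 / ((n + 1 : ℕ) : ℝ)
  have he : Filter.Tendsto e Filter.atTop (𝓝 0) := by
    simpa [e] using tendsto_one_div_add_atTop_nhds_zero_nat (𝕜 := ℝ)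
  have he0 : ∀ n, e n ≠ 0 := fun n => one_div_ne_zero (Nat.cast_ne_zero.2 n.succ_ne_zero)
  -- The planes `U n` converge, so two of them lie in the same open simplex.
  let U : ℕ → InfGrassmannian (m + 3) := fun n => InfGrassmannian.chainPlane m 0 (e n) 0
  have hU : Filter.Tendsto U Filter.atTop (𝓝 (InfGrassmannian.chainPlane m 0 0 0)) :=
    InfGrassmannian.tendsto_chainPlane m 0 he tendsto_const_nhds
  obtain ⟨s, hs⟩ := exists_infinite_carrier_eq (T := T) hU
  obtain ⟨p, hp, q, hq, hpq⟩ := hs.nontrivial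
  -- The planes `V n` of a fixed matroid prescribing the cross-ratio converge to `U p`.
  let V : ℕ → InfGrassmannian (m + 3) := fun n =>
    InfGrassmannian.chainPlane m (p + 1 + 2) (e p) (e n)
  have hV : Filter.Tendsto V Filter.atTop (𝓝 (U p)) := by
    have h : Filter.Tendsto V Filter.atTop
        (𝓝 (InfGrassmannian.chainPlane m (p + 1 + 2) (e p) 0)) :=
      InfGrassmannian.tendsto_chainPlane m (p + 1 + 2) tendsto_const_nhds he
    rwa [InfGrassmannian.chainPlane_zero_right] at h
  obtain ⟨n, hn⟩ := exists_mem_closure_openSimplex (T := T) (b := U q) hV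
    (Eq.trans hq (Eq.symm hp))
  have hsub : T.openSimplex (T.carrier (V n)) ⊆
      InfGrassmannian.crossRatioLocus (m + 3) ((p + 1 : ℕ) : ℝ) := by
    intro W hW
    have hVn : V n ∈ T.openSimplex (T.carrier (V n)) := mem_openSimplex_iff.2 rfl
    exact InfGrassmannian.mem_crossRatioLocus_of_zeros_eq p.succ_pos (he0 n)
      (hT _ (carrier_mem_faces _) W hW _ hVn) (hT _ (carrier_mem_faces _) _ hVn W hW)
  have hq' : ((p + 1 : ℕ) : ℝ) * e q = 1 := InfGrassmannian.eq_of_chainPlane_mem_crossRatioLocus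
    (closure_minimal hsub (InfGrassmannian.isClosed_crossRatioLocus _) hn)
  refine hpq ?_
  have hq0 : ((q + 1 : ℕ) : ℝ) ≠ 0 := Nat.cast_ne_zero.2 q.succ_ne_zero
  have h : ((p + 1 : ℕ) : ℝ) = ((q + 1 : ℕ) : ℝ) := by
    rwa [mul_one_div, div_eq_one_iff_eq hq0] at hq'
  exact Nat.succ_injective (Nat.cast_injective h)

end Triangulation

theorem mainTheorem1 (k : ℕ) (hk : 3 ≤ k) {ι : Type*}
    (T : Triangulation ι (InfGrassmannian k)) :
    ¬ T.IsTame ∧ ¬ T.RefinesOrientedStratification := by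
  obtain ⟨m, rfl⟩ := Nat.exists_eq_add_of_le' hk
  exact ⟨T.not_isTame, fun h => T.not_isTame h.isTame⟩
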